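/- Let $\mathcal{A} = \mathbb{C}[q,q^{-1}]_{(q-1)}$ be the localization of the Laurent polynomial ring $\mathbb{C}[q,q^{-1}]$ at the prime ideal generated by $q-1$, and let $l$ be a natural number. Let $\mathfrak{B}_{q,l}(\mathcal{A})$ be the unital associative $\mathcal{A}$-algebra generated by elements $\mathsf{t}_i, \mathsf{c}_i$ for $1\le i\le l-1$ subject to the relations $$(\mathsf{t}_i-q)(\mathsf{t}_i+q^{-1}) = 0,\quad \mathsf{c}_i^2=0,\quad \mathsf{c}_i \mathsf{t}_i = -q^{-1} \mathsf{c}_i,\quad \mathsf{t}_i \mathsf{c}_i = q \mathsf{c}_i \qquad (1\le i \le l-1);$$ $$\mathsf{t}_i \mathsf{t}_j = \mathsf{t}_j \mathsf{t}_i,\quad \mathsf{t}_i \mathsf{c}_j = \mathsf{c}_j \mathsf{t}_i,\quad \mathsf{c}_i \mathsf{c}_j = \mathsf{c}_j \mathsf{c}_i \qquad (1\le i,j\le l-1,\ |i-j|\ge 2);$$ $$\mathsf{t}_i \mathsf{t}_{i+1} \mathsf{t}_i = \mathsf{t}_{i+1} \mathsf{t}_i \mathsf{t}_{i+1},\quad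 \mathsf{c}_{i+1} \mathsf{c}_i \mathsf{c}_{i+1} = -\mathsf{c}_{i+1},\quad \mathsf{c}_i \mathsf{c}_{i+1} \mathsf{c}_i = - \mathsf{c}_i \qquad (1\le i \le l-2);$$ $$\mathsf{t}_i \mathsf{c}_{i+1} \mathsf{c}_i = -\mathsf{t}_{i+1} \mathsf{c}_i + (q-q^{-1}) \mathsf{c}_{i+1} \mathsf{c}_i,\quad \mathsf{c}_{i+1} \mathsf{c}_i \mathsf{t}_{i+1} = -\mathsf{c}_{i+1} \mathsf{t}_i + (q-q^{-1}) \mathsf{c}_{i+1} \mathsf{c}_i \qquad (1\le i\le l-2).$$ Let $A_l$ be Moon's periplectic Brauer algebra, that is, the unital associative $\mathbb{C}$-algebra generated by elements $s_i, e_i$ for $1\le i\le l-1$ subject to the relations $$s_i^2 = 1,\quad e_i^2=0,\quad e_i s_i = -e_i,\quad s_i e_i = e_i \qquad (1\le i \le l-1);$$ $$s_i s_j = s_j s_i,\quad s_i e_j = e_j s_i,\quad e_i e_j = e_j e_i \qquad (1\le i,j\le l-1,\ |i-j|\ge 2);$$ $$s_i s_{i+1} s_i = s_{i+1} s_i s_{i+1},\quad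 e_{i+1} e_i e_{i+1} = -e_{i+1},\quad e_i e_{i+1} e_i = - e_i \qquad (1\le i \le l-2);$$ $$s_i e_{i+1} e_i = -s_{i+1} e_i,\quad e_{i+1} e_i s_{i+1} = -e_{i+1} s_i \qquad (1\le i\le l-2).$$ Then the quotient algebra $\mathfrak{B}_{q,l}(\mathcal{A})/(q-1)\mathfrak{B}_{q,l}(\mathcal{A})$ is isomorphic to $A_l$ as a $\mathbb{C}$-algebra. -/

import Mathlib

open scoped LaurentPolynomial

noncomputable section

namespace PeriplecticBrauer

/-! ### The periplectic `q`-Brauer algebra over a commutative ring with an invertible `q` -/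

/-- The generators `t_i`, `c_i` of the periplectic `q`-Brauer algebra, `1 ≤ i ≤ l - 1`.
The index set `{1, …, l - 1}` is modelled by `Fin (l - 1)`. -/
inductive QGen (l : ℕ) : Type
  | t (i : Fin (l - 1)) : QGen l
  | c (i : Fin (l - 1)) : QGen l

section QBrauer

variable {R : Type*} [CommRing R] {l : ℕ}

/-- The free generator `t_i`. -/
def freeT (R : Type*) [CommRing R] {l : ℕ} (i : Fin (l - 1)) : FreeAlgebra R (QGen l) :=
  FreeAlgebra.ι R (QGen.t i)

/-- The free generator `c_i`. -/
def freeC (R : Type*) [CommRing R] {l : ℕ} (i : Fin (l - 1)) : FreeAlgebra R (QGen l) :=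
  FreeAlgebra.ι R (QGen.c i)

/-- The element `a` of the ground ring, as an element of the free algebra. -/
def freeScalar {R : Type*} [CommRing R] (l : ℕ) (a : R) : FreeAlgebra R (QGen l) :=
  algebraMap R (FreeAlgebra R (QGen l)) a

/-- The defining relations of the periplectic `q`-Brauer algebra. -/
inductive QRel (q : Rˣ) : FreeAlgebra R (QGen l) → FreeAlgebra R (QGen l) → Prop
  /-- `(t_i - q)(t_i + q⁻¹) = 0` -/
  | quadratic (i : Fin (l - 1)) :
      QRel q ((freeT R i - freeScalar l (q : R)) * (freeT R i + freeScalar l ((q⁻¹ : Rˣ) : R))) 0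
  /-- `c_i² = 0` -/
  | c_sq (i : Fin (l - 1)) : QRel q (freeC R i ^ 2) 0
  /-- `c_i t_i = -q⁻¹ c_i` -/
  | c_t (i : Fin (l - 1)) :
      QRel q (freeC R i * freeT R i) (-(((q⁻¹ : Rˣ) : R) • freeC R i))
  /-- `t_i c_i = q c_i` -/
  | t_c (i : Fin (l - 1)) :
      QRel q (freeT R i * freeC R i) ((q : R) • freeC R i)
  /-- `t_i t_j = t_j t_i` if `|i - j| ≥ 2` -/
  | t_t_far (i j : Fin (l - 1)) (h : 2 ≤ |(i : ℤ) - (j : ℤ)|) :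
      QRel q (freeT R i * freeT R j) (freeT R j * freeT R i)
  /-- `t_i c_j = c_j t_i` if `|i - j| ≥ 2` -/
  | t_c_far (i j : Fin (l - 1)) (h : 2 ≤ |(i : ℤ) - (j : ℤ)|) :
      QRel q (freeT R i * freeC R j) (freeC R j * freeT R i)
  /-- `c_i c_j = c_j c_i` if `|i - j| ≥ 2` -/
  | c_c_far (i j : Fin (l - 1)) (h : 2 ≤ |(i : ℤ) - (j : ℤ)|) :
      QRel q (freeC R i * freeC R j) (freeC R j * freeC R i)
  /-- `t_i t_j t_i = t_j t_i t_j` for `j = i + 1` -/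
  | braid (i j : Fin (l - 1)) (h : (j : ℕ) = i + 1) :
      QRel q (freeT R i * freeT R j * freeT R i) (freeT R j * freeT R i * freeT R j)
  /-- `c_j c_i c_j = -c_j` for `j = i + 1` -/
  | c_c_c_up (i j : Fin (l - 1)) (h : (j : ℕ) = i + 1) :
      QRel q (freeC R j * freeC R i * freeC R j) (-freeC R j)
  /-- `c_i c_j c_i = -c_i` for `j = i + 1` -/
  | c_c_c_down (i j : Fin (l - 1)) (h : (j : ℕ) = i + 1) :
      QRel q (freeC R i * freeC R j * freeC R i) (-freeC R i)
  /-- `t_i c_j c_i = -t_j c_i + (q - q⁻¹) c_j c_i` for `j = i + 1` -/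
  | t_c_c (i j : Fin (l - 1)) (h : (j : ℕ) = i + 1) :
      QRel q (freeT R i * freeC R j * freeC R i)
        (-(freeT R j * freeC R i)
          + ((q : R) - ((q⁻¹ : Rˣ) : R)) • (freeC R j * freeC R i))
  /-- `c_j c_i t_j = -c_j t_i + (q - q⁻¹) c_j c_i` for `j = i + 1` -/
  | c_c_t (i j : Fin (l - 1)) (h : (j : ℕ) = i + 1) :
      QRel q (freeC R j * freeC R i * freeT R j)
        (-(freeC R j * freeT R i)
          + ((q : R) - ((q⁻¹ : Rˣ) : R)) • (freeC R j * freeC R i))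

/-- The periplectic `q`-Brauer algebra over `R` with parameter `q ∈ Rˣ`: the unital associative
`R`-algebra given by the generators `t_i`, `c_i` and the relations `QRel`. -/
abbrev QBrauer (R : Type*) [CommRing R] (q : Rˣ) (l : ℕ) : Type _ :=
  RingQuot (QRel (R := R) (l := l) q)

end QBrauer

/-! ### Specialization: `aB` and `B / aB` -/

/-- For `a` in the ground ring `R` of an algebra `B`, the two-sided ideal `aB = {a b | b ∈ B}`. -/
def scalarIdeal {R : Type*} (B : Type*) [CommRing R] [Ring B] [Algebra R B] (a : R) : Ideal B where
  carrier := {x | ∃ b : B, x = a • b}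
  add_mem' := by
    rintro _ _ ⟨b, rfl⟩ ⟨b', rfl⟩
    exact ⟨b + b', (smul_add a b b').symm⟩
  zero_mem' := ⟨0, (smul_zero a).symm⟩
  smul_mem' := by
    rintro x _ ⟨b, rfl⟩
    exact ⟨x * b, by rw [smul_eq_mul, mul_smul_comm]⟩

instance scalarIdeal_isTwoSided {R : Type*} (B : Type*) [CommRing R] [Ring B] [Algebra R B]
    (a : R) : (scalarIdeal B a).IsTwoSided where
  mul_mem_of_left := by
    rintro _ y ⟨b, rfl⟩
    exact ⟨b * y, by rw [smul_mul_assoc]⟩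

/-! ### The ring `𝒜`, the localization of `ℂ[q, q⁻¹]` at the ideal `(q - 1)` -/

/-- The ideal of `ℂ[q, q⁻¹]` generated by `q - 1`. -/
def qSubOneIdeal : Ideal ℂ[T;T⁻¹] :=
  Ideal.span {(LaurentPolynomial.T 1 - 1 : ℂ[T;T⁻¹])}

instance qSubOneIdeal_isPrime : qSubOneIdeal.IsPrime := by
  have hp : (Ideal.span {(Polynomial.X - Polynomial.C 1 : Polynomial ℂ)}).IsPrime :=
    (Ideal.span_singleton_prime (Polynomial.X_sub_C_ne_zero 1)).2 (Polynomial.prime_X_sub_C 1)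
  have hd : Disjoint ((Submonoid.powers (Polynomial.X : Polynomial ℂ)) : Set (Polynomial ℂ))
      (Ideal.span {(Polynomial.X - Polynomial.C 1 : Polynomial ℂ)} : Set (Polynomial ℂ)) := by
    rw [Set.disjoint_left]
    rintro _ ⟨n, rfl⟩ h
    rw [SetLike.mem_coe, Ideal.mem_span_singleton, Polynomial.dvd_iff_isRoot] at h
    simp [Polynomial.IsRoot] at h
  have h := IsLocalization.isPrime_of_isPrime_disjoint
    (Submonoid.powers (Polynomial.X : Polynomial ℂ)) ℂ[T;T⁻¹] _ hp hd
  have he : qSubOneIdeal = Ideal.map (algebraMap (Polynomial ℂ) ℂ[T;T⁻¹])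
      (Ideal.span {(Polynomial.X - Polynomial.C 1 : Polynomial ℂ)}) := by
    rw [Ideal.map_span, Set.image_singleton, qSubOneIdeal]
    simp [LaurentPolynomial.algebraMap_eq_toLaurent]
  rw [he]
  exact h

/-- `𝒜 = ℂ[q, q⁻¹]_{(q - 1)}`. -/
abbrev LocA : Type := Localization.AtPrime qSubOneIdeal

/-- `q`, as a unit of `ℂ[q, q⁻¹]`. -/
def qLaurent : ℂ[T;T⁻¹]ˣ where
  val := LaurentPolynomial.T 1
  inv := LaurentPolynomial.T (-1)
  val_inv := by rw [← LaurentPolynomial.T_add]; simp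
  inv_val := by rw [← LaurentPolynomial.T_add]; simp

/-- `q`, as a unit of `𝒜`. -/
def qA : LocAˣ := Units.map (algebraMap ℂ[T;T⁻¹] LocA).toMonoidHom qLaurent

/-! ### Moon's periplectic Brauer algebra -/

/-- The generators `s_i`, `e_i` of Moon's algebra, `1 ≤ i ≤ l - 1`, indexed by `Fin (l - 1)`. -/
inductive MGen (l : ℕ) : Type
  | s (i : Fin (l - 1)) : MGen l
  | e (i : Fin (l - 1)) : MGen l

/-- The free generator `s_i`. -/
def freeS {l : ℕ} (i : Fin (l - 1)) : FreeAlgebra ℂ (MGen l) :=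
  FreeAlgebra.ι ℂ (MGen.s i)

/-- The free generator `e_i`. -/
def freeE {l : ℕ} (i : Fin (l - 1)) : FreeAlgebra ℂ (MGen l) :=
  FreeAlgebra.ι ℂ (MGen.e i)

/-- The defining relations of Moon's periplectic Brauer algebra. -/
inductive MRel {l : ℕ} : FreeAlgebra ℂ (MGen l) → FreeAlgebra ℂ (MGen l) → Prop
  /-- `s_i² = 1` -/
  | s_sq (i : Fin (l - 1)) : MRel (freeS i ^ 2) 1
  /-- `e_i² = 0` -/
  | e_sq (i : Fin (l - 1)) : MRel (freeE i ^ 2) 0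
  /-- `e_i s_i = -e_i` -/
  | e_s (i : Fin (l - 1)) : MRel (freeE i * freeS i) (-freeE i)
  /-- `s_i e_i = e_i` -/
  | s_e (i : Fin (l - 1)) : MRel (freeS i * freeE i) (freeE i)
  /-- `s_i s_j = s_j s_i` if `|i - j| ≥ 2` -/
  | s_s_far (i j : Fin (l - 1)) (h : 2 ≤ |(i : ℤ) - (j : ℤ)|) :
      MRel (freeS i * freeS j) (freeS j * freeS i)
  /-- `s_i e_j = e_j s_i` if `|i - j| ≥ 2` -/
  | s_e_far (i j : Fin (l - 1)) (h : 2 ≤ |(i : ℤ) - (j : ℤ)|) :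
      MRel (freeS i * freeE j) (freeE j * freeS i)
  /-- `e_i e_j = e_j e_i` if `|i - j| ≥ 2` -/
  | e_e_far (i j : Fin (l - 1)) (h : 2 ≤ |(i : ℤ) - (j : ℤ)|) :
      MRel (freeE i * freeE j) (freeE j * freeE i)
  /-- `s_i s_j s_i = s_j s_i s_j` for `j = i + 1` -/
  | braid (i j : Fin (l - 1)) (h : (j : ℕ) = i + 1) :
      MRel (freeS i * freeS j * freeS i) (freeS j * freeS i * freeS j)
  /-- `e_j e_i e_j = -e_j` for `j = i + 1` -/
  | e_e_e_up (i j : Fin (l - 1)) (h : (j : ℕ) = i + 1) :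
      MRel (freeE j * freeE i * freeE j) (-freeE j)
  /-- `e_i e_j e_i = -e_i` for `j = i + 1` -/
  | e_e_e_down (i j : Fin (l - 1)) (h : (j : ℕ) = i + 1) :
      MRel (freeE i * freeE j * freeE i) (-freeE i)
  /-- `s_i e_j e_i = -s_j e_i` for `j = i + 1` -/
  | s_e_e (i j : Fin (l - 1)) (h : (j : ℕ) = i + 1) :
      MRel (freeS i * freeE j * freeE i) (-(freeS j * freeE i))
  /-- `e_j e_i s_j = -e_j s_i` for `j = i + 1` -/
  | e_e_s (i j : Fin (l - 1)) (h : (j : ℕ) = i + 1) :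
      MRel (freeE j * freeE i * freeS j) (-(freeE j * freeS i))

/-- Moon's periplectic Brauer algebra `A_l` over `ℂ`: the unital associative `ℂ`-algebra given by
the generators `s_i`, `e_i` and the relations `MRel`. -/
abbrev MoonAlgebra (l : ℕ) : Type := RingQuot (MRel (l := l))

end PeriplecticBrauer

end

/-!
Modulo `q - 1` the parameter `q` acts as `1`, and then the relations of the `q`-Brauer algebra are
those of Moon's algebra: the terms with coefficient `q - q⁻¹` vanish and `(t - q)(t + q⁻¹) = 0`
reads `t² = 1`. Hence the specialization at `q = 1` and Moon's algebra map to each other, compatibly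
with the generators. The composite on Moon's algebra is the identity, and the map out of Moon's
algebra is surjective because every element of the ground ring is congruent to a complex number
modulo `q - 1`.
-/

noncomputable section

namespace PeriplecticBrauer

section Families

variable {R B C : Type*} [CommRing R] [Ring B] [Algebra R B] [Ring C] [Algebra R C] {l : ℕ}

/-- The map on the generators of the `q`-Brauer algebra with `t_i ↦ t i` and `c_i ↦ c i`. -/
def qGenElim (t c : Fin (l - 1) → B) : QGen l → B
  | .t i => t i
  | .c i => c i

/-- The map on the generators of Moon's algebra with `s_i ↦ s i` and `e_i ↦ e i`. -/
def mGenElim (s e : Fin (l - 1) → B) : MGen l → B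
  | .s i => s i
  | .e i => e i

/-- The elements `t i`, `c i` of an `R`-algebra satisfy the defining relations of the `q`-Brauer
algebra. -/
def IsQBrauerFamily (q : Rˣ) (t c : Fin (l - 1) → B) : Prop :=
  ∀ ⦃x y⦄, QRel q x y → FreeAlgebra.lift R (qGenElim t c) x = FreeAlgebra.lift R (qGenElim t c) y

/-- The elements `s i`, `e i` of a `ℂ`-algebra satisfy the defining relations of Moon's algebra. -/
def IsMoonFamily [Algebra ℂ B] (s e : Fin (l - 1) → B) : Prop :=
  ∀ ⦃x y⦄, MRel x y → FreeAlgebra.lift ℂ (mGenElim s e) x = FreeAlgebra.lift ℂ (mGenElim s e) y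

@[simp]
lemma lift_qGenElim_freeT (t c : Fin (l - 1) → B) (i : Fin (l - 1)) :
    FreeAlgebra.lift R (qGenElim t c) (freeT R i) = t i :=
  FreeAlgebra.lift_ι_apply _ _

@[simp]
lemma lift_qGenElim_freeC (t c : Fin (l - 1) → B) (i : Fin (l - 1)) :
    FreeAlgebra.lift R (qGenElim t c) (freeC R i) = c i :=
  FreeAlgebra.lift_ι_apply _ _

@[simp]
lemma lift_qGenElim_freeScalar (t c : Fin (l - 1) → B) (a : R) :
    FreeAlgebra.lift R (qGenElim t c) (freeScalar l a) = algebraMap R B a :=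
  AlgHom.commutes _ a

@[simp]
lemma lift_mGenElim_freeS [Algebra ℂ B] (s e : Fin (l - 1) → B) (i : Fin (l - 1)) :
    FreeAlgebra.lift ℂ (mGenElim s e) (freeS i) = s i :=
  FreeAlgebra.lift_ι_apply _ _

@[simp]
lemma lift_mGenElim_freeE [Algebra ℂ B] (s e : Fin (l - 1) → B) (i : Fin (l - 1)) :
    FreeAlgebra.lift ℂ (mGenElim s e) (freeE i) = e i :=
  FreeAlgebra.lift_ι_apply _ _

lemma IsQBrauerFamily.map {q : Rˣ} {t c : Fin (l - 1) → B} (h : IsQBrauerFamily q t c)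
    (f : B →ₐ[R] C) : IsQBrauerFamily q (f ∘ t) (f ∘ c) := by
  have lift_map : FreeAlgebra.lift R (qGenElim (f ∘ t) (f ∘ c)) =
      f.comp (FreeAlgebra.lift R (qGenElim t c)) := by
    ext (i | i) <;> simp [qGenElim]
  intro x y hxy
  simp only [lift_map, AlgHom.comp_apply, h hxy]

/-- The homomorphism from the `q`-Brauer algebra determined by the images of its generators. -/
def IsQBrauerFamily.lift {q : Rˣ} {t c : Fin (l - 1) → B} (h : IsQBrauerFamily q t c) :
    QBrauer R q l →ₐ[R] B :=
  RingQuot.liftAlgHom R ⟨FreeAlgebra.lift R (qGenElim t c), h⟩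

/-- The homomorphism from Moon's algebra determined by the images of its generators. -/
def IsMoonFamily.lift [Algebra ℂ B] {s e : Fin (l - 1) → B} (h : IsMoonFamily s e) :
    MoonAlgebra l →ₐ[ℂ] B :=
  RingQuot.liftAlgHom ℂ ⟨FreeAlgebra.lift ℂ (mGenElim s e), h⟩

/-- The generator `t_i` of the `q`-Brauer algebra. -/
def qBrauerT (q : Rˣ) (i : Fin (l - 1)) : QBrauer R q l :=
  RingQuot.mkAlgHom R (QRel q) (freeT R i)

/-- The generator `c_i` of the `q`-Brauer algebra. -/
def qBrauerC (q : Rˣ) (i : Fin (l - 1)) : QBrauer R q l :=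
  RingQuot.mkAlgHom R (QRel q) (freeC R i)

/-- The generator `s_i` of Moon's algebra. -/
def moonS (i : Fin (l - 1)) : MoonAlgebra l :=
  RingQuot.mkAlgHom ℂ MRel (freeS i)

/-- The generator `e_i` of Moon's algebra. -/
def moonE (i : Fin (l - 1)) : MoonAlgebra l :=
  RingQuot.mkAlgHom ℂ MRel (freeE i)

lemma isQBrauerFamily_generators (q : Rˣ) :
    IsQBrauerFamily q (qBrauerT (l := l) q) (qBrauerC q) := by
  have lift_eq : FreeAlgebra.lift R (qGenElim (qBrauerT (l := l) q) (qBrauerC q)) =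
      RingQuot.mkAlgHom R (QRel q) := by
    ext (i | i) <;> simp [qGenElim, qBrauerT, qBrauerC, freeT, freeC]
  intro x y hxy
  simpa only [lift_eq] using RingQuot.mkAlgHom_rel R hxy

lemma isMoonFamily_generators : IsMoonFamily (moonS (l := l)) moonE := by
  have lift_eq : FreeAlgebra.lift ℂ (mGenElim (moonS (l := l)) moonE) =
      RingQuot.mkAlgHom ℂ MRel := by
    ext (i | i) <;> simp [mGenElim, moonS, moonE, freeS, freeE]
  intro x y hxy
  simpa only [lift_eq] using RingQuot.mkAlgHom_rel ℂ hxy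

@[simp]
lemma IsQBrauerFamily.lift_qBrauerT {q : Rˣ} {t c : Fin (l - 1) → B} (h : IsQBrauerFamily q t c)
    (i : Fin (l - 1)) : h.lift (qBrauerT q i) = t i :=
  (RingQuot.liftAlgHom_mkAlgHom_apply _ _ h _).trans (lift_qGenElim_freeT _ _ i)

@[simp]
lemma IsQBrauerFamily.lift_qBrauerC {q : Rˣ} {t c : Fin (l - 1) → B} (h : IsQBrauerFamily q t c)
    (i : Fin (l - 1)) : h.lift (qBrauerC q i) = c i :=
  (RingQuot.liftAlgHom_mkAlgHom_apply _ _ h _).trans (lift_qGenElim_freeC _ _ i)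

@[simp]
lemma IsMoonFamily.lift_moonS [Algebra ℂ B] {s e : Fin (l - 1) → B} (h : IsMoonFamily s e)
    (i : Fin (l - 1)) : h.lift (moonS i) = s i :=
  (RingQuot.liftAlgHom_mkAlgHom_apply _ _ h _).trans (lift_mGenElim_freeS _ _ i)

@[simp]
lemma IsMoonFamily.lift_moonE [Algebra ℂ B] {s e : Fin (l - 1) → B} (h : IsMoonFamily s e)
    (i : Fin (l - 1)) : h.lift (moonE i) = e i :=
  (RingQuot.liftAlgHom_mkAlgHom_apply _ _ h _).trans (lift_mGenElim_freeE _ _ i)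

lemma moonAlgebra_algHom_ext [Algebra ℂ B] {f g : MoonAlgebra l →ₐ[ℂ] B}
    (hs : ∀ i, f (moonS i) = g (moonS i)) (he : ∀ i, f (moonE i) = g (moonE i)) : f = g := by
  refine RingQuot.ringQuot_ext' ℂ f g (FreeAlgebra.hom_ext (funext ?_))
  rintro (i | i)
  exacts [hs i, he i]

lemma qBrauer_induction {q : Rˣ} {motive : QBrauer R q l → Prop}
    (algebraMap : ∀ r, motive (algebraMap R _ r)) (t : ∀ i, motive (qBrauerT q i))
    (c : ∀ i, motive (qBrauerC q i)) (mul : ∀ x y, motive x → motive y → motive (x * y))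
    (add : ∀ x y, motive x → motive y → motive (x + y)) (x : QBrauer R q l) : motive x := by
  obtain ⟨x, rfl⟩ := RingQuot.mkAlgHom_surjective R _ x
  induction x with
  | grade0 r => simpa only [AlgHom.commutes] using algebraMap r
  | grade1 g => rcases g with i | i; exacts [t i, c i]
  | mul x y hx hy => simpa only [map_mul] using mul _ _ hx hy
  | add x y hx hy => simpa only [map_add] using add _ _ hx hy

end Families

section ParameterOne

variable {R B : Type*} [CommRing R] [Ring B] [Algebra R B] {l : ℕ} {q : Rˣ}
  {t c : Fin (l - 1) → B}

lemma algebraMap_inv_eq_one (hq : algebraMap R B q = 1) : algebraMap R B ↑q⁻¹ = 1 := by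
  have h : algebraMap R B (q * ↑q⁻¹) = 1 := by rw [Units.mul_inv, map_one]
  rwa [map_mul, hq, one_mul] at h

lemma sub_one_mul_add_one_eq_zero_iff (b : B) : (b - 1) * (b + 1) = 0 ↔ b ^ 2 = 1 := by
  have factor : (b - 1) * (b + 1) = b ^ 2 - 1 := by noncomm_ring
  rw [factor, sub_eq_zero]

variable [Algebra ℂ B]

lemma IsMoonFamily.isQBrauerFamily (hq : algebraMap R B q = 1) (h : IsMoonFamily t c) :
    IsQBrauerFamily q t c := by
  have hq' := algebraMap_inv_eq_one hq
  intro x y hxy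
  cases hxy with
  | quadratic i =>
    simpa [hq, hq', sub_one_mul_add_one_eq_zero_iff] using h (.s_sq i)
  | c_sq i => simpa using h (.e_sq i)
  | c_t i => simpa [Algebra.smul_def, hq'] using h (.e_s i)
  | t_c i => simpa [Algebra.smul_def, hq] using h (.s_e i)
  | t_t_far i j hij => simpa using h (.s_s_far i j hij)
  | t_c_far i j hij => simpa using h (.s_e_far i j hij)
  | c_c_far i j hij => simpa using h (.e_e_far i j hij)
  | braid i j hij => simpa using h (.braid i j hij)
  | c_c_c_up i j hij => simpa using h (.e_e_e_up i j hij)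
  | c_c_c_down i j hij => simpa using h (.e_e_e_down i j hij)
  | t_c_c i j hij => simpa [Algebra.smul_def, hq, hq'] using h (.s_e_e i j hij)
  | c_c_t i j hij => simpa [Algebra.smul_def, hq, hq'] using h (.e_e_s i j hij)

lemma IsQBrauerFamily.isMoonFamily (hq : algebraMap R B q = 1) (h : IsQBrauerFamily q t c) :
    IsMoonFamily t c := by
  have hq' := algebraMap_inv_eq_one hq
  intro x y hxy
  cases hxy with
  | s_sq i =>
    simpa [hq, hq', sub_one_mul_add_one_eq_zero_iff] using h (.quadratic i)
  | e_sq i => simpa using h (.c_sq i)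
  | e_s i => simpa [Algebra.smul_def, hq'] using h (.c_t i)
  | s_e i => simpa [Algebra.smul_def, hq] using h (.t_c i)
  | s_s_far i j hij => simpa using h (.t_t_far i j hij)
  | s_e_far i j hij => simpa using h (.t_c_far i j hij)
  | e_e_far i j hij => simpa using h (.c_c_far i j hij)
  | braid i j hij => simpa using h (.braid i j hij)
  | e_e_e_up i j hij => simpa using h (.c_c_c_up i j hij)
  | e_e_e_down i j hij => simpa using h (.c_c_c_down i j hij)
  | s_e_e i j hij => simpa [Algebra.smul_def, hq, hq'] using h (.t_c_c i j hij)
  | e_e_s i j hij => simpa [Algebra.smul_def, hq, hq'] using h (.c_c_t i j hij)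

end ParameterOne

section ScalarIdeal

variable {R B C : Type*} [CommRing R] [Ring B] [Algebra R B] [Ring C] [Algebra R C] {a : R}

lemma algebraMap_quotient_scalarIdeal_eq_zero {r : R} (hr : r ∈ Ideal.span {a}) :
    algebraMap R (B ⧸ scalarIdeal B a) r = 0 := by
  obtain ⟨b, rfl⟩ := Ideal.mem_span_singleton'.1 hr
  refine Ideal.Quotient.eq_zero_iff_mem.2 ⟨algebraMap R B b, ?_⟩
  rw [Algebra.smul_def, ← map_mul, mul_comm]

lemma algHom_eq_zero_of_mem_scalarIdeal (f : B →ₐ[R] C) (ha : algebraMap R C a = 0) {x : B}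
    (hx : x ∈ scalarIdeal B a) : f x = 0 := by
  obtain ⟨b, rfl⟩ := hx
  rw [map_smul, Algebra.smul_def, ha, zero_mul]

end ScalarIdeal

section Specialization

/-- The specialization of the `q`-Brauer algebra at `q = 1`. -/
abbrev QBrauerAtOne (R : Type*) [CommRing R] (q : Rˣ) (l : ℕ) : Type _ :=
  QBrauer R q l ⧸ scalarIdeal (QBrauer R q l) ((q : R) - 1)

variable {R : Type*} [CommRing R] (q : Rˣ) (l : ℕ)

lemma algebraMap_qBrauerAtOne_q : algebraMap R (QBrauerAtOne R q l) q = 1 := by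
  have h := algebraMap_quotient_scalarIdeal_eq_zero (B := QBrauer R q l)
    (Ideal.mem_span_singleton_self ((q : R) - 1))
  rwa [map_sub, map_one, sub_eq_zero] at h

/-- The homomorphism `t_i ↦ s_i`, `c_i ↦ e_i`, for any action of `R` on Moon's algebra through
scalars in which `q` acts as `1`. -/
def qBrauerAtOneToMoon [Algebra R (MoonAlgebra l)] (hq : algebraMap R (MoonAlgebra l) q = 1) :
    QBrauerAtOne R q l →ₐ[R] MoonAlgebra l :=
  Ideal.Quotient.liftₐ _ (isMoonFamily_generators.isQBrauerFamily hq).lift fun _ hx =>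
    algHom_eq_zero_of_mem_scalarIdeal _ (by rw [map_sub, map_one, hq, sub_self]) hx

lemma qBrauerAtOneToMoon_t [Algebra R (MoonAlgebra l)] (hq : algebraMap R (MoonAlgebra l) q = 1)
    (i : Fin (l - 1)) :
    qBrauerAtOneToMoon q l hq (Ideal.Quotient.mk _ (qBrauerT q i)) = moonS i :=
  IsQBrauerFamily.lift_qBrauerT _ i

lemma qBrauerAtOneToMoon_c [Algebra R (MoonAlgebra l)] (hq : algebraMap R (MoonAlgebra l) q = 1)
    (i : Fin (l - 1)) :
    qBrauerAtOneToMoon q l hq (Ideal.Quotient.mk _ (qBrauerC q i)) = moonE i :=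
  IsQBrauerFamily.lift_qBrauerC _ i

variable [Algebra ℂ R]

/-- The homomorphism `s_i ↦ t_i`, `e_i ↦ c_i`. -/
def moonToQBrauerAtOne : MoonAlgebra l →ₐ[ℂ] QBrauerAtOne R q l :=
  (((isQBrauerFamily_generators q).map (Ideal.Quotient.mkₐ R _)).isMoonFamily
    (algebraMap_qBrauerAtOne_q q l)).lift

lemma moonToQBrauerAtOne_s (i : Fin (l - 1)) :
    moonToQBrauerAtOne q l (moonS i) = Ideal.Quotient.mk _ (qBrauerT q i) :=
  IsMoonFamily.lift_moonS _ i

lemma moonToQBrauerAtOne_e (i : Fin (l - 1)) :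
    moonToQBrauerAtOne q l (moonE i) = Ideal.Quotient.mk _ (qBrauerC q i) :=
  IsMoonFamily.lift_moonE _ i

lemma qBrauerAtOneToMoon_moonToQBrauerAtOne [Algebra R (MoonAlgebra l)]
    [IsScalarTower ℂ R (MoonAlgebra l)] (hq : algebraMap R (MoonAlgebra l) q = 1)
    (x : MoonAlgebra l) : qBrauerAtOneToMoon q l hq (moonToQBrauerAtOne q l x) = x := by
  have h : ((qBrauerAtOneToMoon q l hq).restrictScalars ℂ).comp (moonToQBrauerAtOne q l) =
      AlgHom.id ℂ _ :=
    moonAlgebra_algHom_ext (by simp [moonToQBrauerAtOne_s, qBrauerAtOneToMoon_t])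
      (by simp [moonToQBrauerAtOne_e, qBrauerAtOneToMoon_c])
  exact DFunLike.congr_fun h x

variable {q} in
lemma algebraMap_qBrauerAtOne_eq {ε : R →ₐ[ℂ] ℂ}
    (hε : RingHom.ker ε ≤ Ideal.span {(q : R) - 1}) (r : R) :
    algebraMap R (QBrauerAtOne R q l) r = algebraMap ℂ _ (ε r) := by
  have hr : r - algebraMap ℂ R (ε r) ∈ Ideal.span {(q : R) - 1} := by
    apply hε
    rw [RingHom.mem_ker, map_sub, AlgHom.commutes, Algebra.algebraMap_self_apply, sub_self]
  rw [IsScalarTower.algebraMap_apply ℂ R (QBrauerAtOne R q l), ← sub_eq_zero, ← map_sub]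
  exact algebraMap_quotient_scalarIdeal_eq_zero hr

variable {q} in
lemma moonToQBrauerAtOne_surjective {ε : R →ₐ[ℂ] ℂ}
    (hε : RingHom.ker ε ≤ Ideal.span {(q : R) - 1}) :
    Function.Surjective (moonToQBrauerAtOne q l) := by
  intro x
  obtain ⟨x, rfl⟩ := Ideal.Quotient.mk_surjective x
  change Ideal.Quotient.mk _ x ∈ (moonToQBrauerAtOne q l).range
  induction x using qBrauer_induction with
  | algebraMap r => exact ⟨algebraMap ℂ _ (ε r),
      (AlgHom.commutes _ _).trans (algebraMap_qBrauerAtOne_eq l hε r).symm⟩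
  | t i => exact ⟨moonS i, moonToQBrauerAtOne_s q l i⟩
  | c i => exact ⟨moonE i, moonToQBrauerAtOne_e q l i⟩
  | mul x y hx hy => simpa only [map_mul] using mul_mem hx hy
  | add x y hx hy => simpa only [map_add] using add_mem hx hy

end Specialization

section EvaluationAtOne

open LaurentPolynomial

lemma T_sub_C_dvd_of_eval₂_eq_zero {K : Type*} [CommRing K] (u : Kˣ) {p : K[T;T⁻¹]}
    (hp : eval₂ (RingHom.id K) u p = 0) : T 1 - C (u : K) ∣ p := by
  induction p using LaurentPolynomial.induction_on_mul_T with
  | _ f n =>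
    have hf : f.IsRoot u := by
      rwa [map_mul, eval₂_toLaurent, eval₂_T, Units.mul_left_eq_zero] at hp
    have hdvd := map_dvd Polynomial.toLaurent (Polynomial.dvd_iff_isRoot.2 hf)
    rw [map_sub, Polynomial.toLaurent_X, Polynomial.toLaurent_C] at hdvd
    exact hdvd.mul_right _

lemma ker_eq_map_of_surjective_localization_atPrime {A K : Type*} [CommRing A] [DivisionRing K]
    (P : Ideal A) [P.IsPrime] (f : Localization.AtPrime P →+* K) (hf : Function.Surjective f) :
    RingHom.ker f = P.map (algebraMap A (Localization.AtPrime P)) := by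
  rw [Localization.AtPrime.map_eq_maximalIdeal]
  exact IsLocalRing.eq_maximalIdeal (RingHom.ker_isMaximal_of_surjective f hf)

/-- Evaluation of complex Laurent polynomials at `q = 1`. -/
def laurentEvalOne : ℂ[T;T⁻¹] →ₐ[ℂ] ℂ where
  __ := eval₂ (RingHom.id ℂ) 1
  commutes' z := eval₂_C _ _ z

lemma isUnit_laurentEvalOne (p : qSubOneIdeal.primeCompl) : IsUnit (laurentEvalOne p) := by
  refine isUnit_iff_ne_zero.2 fun hp => p.2 (Ideal.mem_span_singleton.2 ?_)
  simpa using T_sub_C_dvd_of_eval₂_eq_zero 1 hp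

/-- Evaluation `𝒜 → ℂ` at `q = 1`. -/
def evalOne : LocA →ₐ[ℂ] ℂ :=
  IsLocalization.liftAlgHom (M := qSubOneIdeal.primeCompl) isUnit_laurentEvalOne

lemma ker_evalOne : RingHom.ker evalOne = Ideal.span {(qA : LocA) - 1} := by
  have hsurj : Function.Surjective evalOne := fun z => ⟨algebraMap ℂ LocA z, evalOne.commutes z⟩
  calc RingHom.ker evalOne = qSubOneIdeal.map (algebraMap _ LocA) :=
        ker_eq_map_of_surjective_localization_atPrime _ (evalOne : LocA →+* ℂ) hsurj
    _ = Ideal.span {(qA : LocA) - 1} := by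
        change Ideal.map _ (Ideal.span {T 1 - 1}) = _
        rw [Ideal.map_span, Set.image_singleton, map_sub, map_one]
        rfl

end EvaluationAtOne

end PeriplecticBrauer

open PeriplecticBrauer in
theorem proposition5p5_general {R : Type*} [CommRing R] [Algebra ℂ R] (q : Rˣ) (ε : R →ₐ[ℂ] ℂ)
    (hε : RingHom.ker ε = Ideal.span {(q : R) - 1}) (l : ℕ) :
    Nonempty ((QBrauer R q l ⧸ scalarIdeal (QBrauer R q l) ((q : R) - 1)) ≃ₐ[ℂ] MoonAlgebra l) := by
  let : Algebra R (MoonAlgebra l) := Algebra.compHom _ (ε : R →+* ℂ)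
  have hmap (r : R) : algebraMap R (MoonAlgebra l) r = algebraMap ℂ _ (ε r) := rfl
  have : IsScalarTower ℂ R (MoonAlgebra l) := .of_algebraMap_eq fun z => by
    rw [hmap, AlgHom.commutes, Algebra.algebraMap_self_apply]
  have hεq : ε q = 1 := by
    rw [← sub_eq_zero, ← map_one ε, ← map_sub, ← RingHom.mem_ker, hε]
    exact Ideal.mem_span_singleton_self _
  have hq : algebraMap R (MoonAlgebra l) q = 1 := by rw [hmap, hεq, map_one]
  have hinj : Function.Injective (moonToQBrauerAtOne q l) :=
    Function.LeftInverse.injective (qBrauerAtOneToMoon_moonToQBrauerAtOne q l hq)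
  exact ⟨(AlgEquiv.ofBijective _ ⟨hinj, moonToQBrauerAtOne_surjective l hε.le⟩).symm⟩

end

theorem proposition5p5 (l : ℕ) :
    Nonempty
      ((PeriplecticBrauer.QBrauer PeriplecticBrauer.LocA PeriplecticBrauer.qA l ⧸
          PeriplecticBrauer.scalarIdeal
            (PeriplecticBrauer.QBrauer PeriplecticBrauer.LocA PeriplecticBrauer.qA l)
            ((PeriplecticBrauer.qA : PeriplecticBrauer.LocA) - 1))
        ≃ₐ[ℂ] PeriplecticBrauer.MoonAlgebra l) :=
  proposition5p5_general PeriplecticBrauer.qA PeriplecticBrauer.evalOne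
    PeriplecticBrauer.ker_evalOne l
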